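/- Let $n\in\mathbb N=\{1,2,\dots\}$ and let $d\in\mathbb N\cup\{\infty\}$ with $d\ge 2$. All sequences $s=(s_\alpha)$ below are real and indexed by the $\alpha\in\mathbb N_0^n$ with $|\alpha|=\alpha_1+\dots+\alpha_n\le d$ (all $\alpha\in\mathbb N_0^n$ if $d=\infty$). Let $\mathcal S_d$ (the moment cone) be the set of all such sequences for which there is a positive Borel measure $\mu$ on $\mathbb R^n$ such that every $x^\alpha$ with $|\alpha|\le d$ is $\mu$-integrable and $s_\alpha=\int_{\mathbb R^n}x^\alpha\,\mathrm d\mu(x)$. For finite $d$, $\partial\mathcal S_d$ denotes the topological boundary of $\mathcal S_d$ in the finite-dimensional real vector space of all sequences $(s_\alpha)_{|\alpha|\le d}$. For a sequence $s$ let $\mathfrak p_s=(\mathfrak p_{s,\alpha})_{|\alpha|\le d}$ be its heat polynomials, i.e. the unique family in $\mathbb R[t]$ with \[\mathfrak p_{s,\alpha}(0)=s_\alpha,\qquad \partial_t\mathfrak p_{s,\alpha}(t)=\sum_{j=1}^n\alpha_j(\alpha_j-1)\,\mathfrak p_{s,\alpha-2e_j}(t)\] (terms with $\alpha_j\le 1$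 are $0$), where $e_j$ is the $j$-th unit vector; explicitly, \[\mathfrak p_{s,\alpha}(t)=\sum_{\beta\in\mathbb N_0^n:\,2\beta\le\alpha}\ \prod_{j=1}^n\frac{\alpha_j!}{(\alpha_j-2\beta_j)!\,\beta_j!}\; s_{\alpha-2\beta}\,t^{|\beta|}.\] Let $s\in\mathcal S_d$ with $s\ne 0$, and put \[\mathfrak I_s:=\{t\in\mathbb R\mid \mathfrak p_s(t)\in\mathcal S_d\},\qquad \mathfrak d_s:=-\inf\mathfrak I_s .\] Then $\mathfrak I_s=[-\mathfrak d_s,\infty)$ or $\mathfrak I_s=(-\mathfrak d_s,\infty)$, and \[\mathfrak d_s\in\left[0,\ \frac{s_{2e_1}+\dots+s_{2e_n}}{2n\cdot s_0}\right].\] If $d=\infty$, then always $\mathfrak I_s=[-\mathfrak d_s,\infty)$. If $d$ is finite, then $\mathfrak I_s=[-\mathfrak d_s,\infty)$ if and only if $\mathfrak p_s(-\mathfrak d_s)\in\partial\mathcal S_d\cap\mathcal S_d$. -/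

import Mathlib

section HeatMoments

open Polynomial
open scoped Nat

/-- Multi-indices `α ∈ ℕ₀ⁿ` with `|α| = α₁ + ⋯ + αₙ ≤ d`, where `d ∈ ℕ₀ ∪ {∞}`. -/
abbrev MultiIdx (n : ℕ) (d : ℕ∞) : Type :=
  {α : Fin n → ℕ // ((∑ i, α i : ℕ) : ℕ∞) ≤ d}

/-- Real sequences `(s_α)_{|α| ≤ d}`, a full sequence for `d = ⊤`. The topology is the product
topology; for finite `d` it is the usual topology of a finite-dimensional real vector space. -/
abbrev MomSeq (n : ℕ) (d : ℕ∞) : Type := MultiIdx n d → ℝ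

/-- The moment cone: all (truncated, or full for `d = ⊤`) moment sequences of positive Borel
measures on `ℝⁿ` for which all monomials of degree at most `d` are integrable. -/
def momentCone (n : ℕ) (d : ℕ∞) : Set (MomSeq n d) :=
  {s | ∃ μ : MeasureTheory.Measure (Fin n → ℝ), ∀ α : MultiIdx n d,
    MeasureTheory.Integrable (fun x : Fin n → ℝ => ∏ i, x i ^ α.1 i) μ ∧
      s α = ∫ x, ∏ i, x i ^ α.1 i ∂μ}

/-- The multi-index `0`. -/
def MultiIdx.zero (n : ℕ) (d : ℕ∞) : MultiIdx n d := ⟨0, by simp⟩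

/-- The multi-index `2 e_j`, available as soon as `d ≥ 2`. -/
def MultiIdx.twoE {n : ℕ} {d : ℕ∞} (hd : 2 ≤ d) (j : Fin n) : MultiIdx n d :=
  ⟨Pi.single j 2, by simpa using hd⟩

/-- The multi-index `α - γ` (truncated subtraction; used for `γ ≤ α`, or with a zero factor). -/
def MultiIdx.lower {n : ℕ} {d : ℕ∞} (α : MultiIdx n d) (γ : Fin n → ℕ) : MultiIdx n d :=
  ⟨fun i => α.1 i - γ i, le_trans
    (by exact_mod_cast Finset.sum_le_sum fun i _ => Nat.sub_le (α.1 i) (γ i)) α.2⟩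

/-- The heat polynomial
`𝔭_{s,α}(t) = ∑_{2β ≤ α} ∏ⱼ αⱼ! / ((αⱼ - 2βⱼ)! βⱼ!) · s_{α - 2β} · t^{|β|}`.
By `heatPoly_unique` below, these are the unique polynomials with `𝔭_{s,α}(0) = s_α` and
`∂ₜ 𝔭_{s,α} = ∑ⱼ αⱼ (αⱼ - 1) 𝔭_{s,α-2eⱼ}`, the evolution of moments under `∂ₜ u = Δ u`. -/
noncomputable def heatPoly {n : ℕ} {d : ℕ∞} (s : MomSeq n d) (α : MultiIdx n d) : ℝ[X] :=
  ∑ β ∈ Fintype.piFinset (fun j : Fin n => Finset.range (α.1 j / 2 + 1)),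
    C ((∏ j, ((α.1 j)! : ℝ) / (((α.1 j - 2 * β j)! : ℝ) * ((β j)! : ℝ))) *
        s (α.lower (fun j => 2 * β j))) * X ^ (∑ j, β j)

/-- The heat flow `𝔭_s(t) = (𝔭_{s,α}(t))_{|α| ≤ d}`. -/
noncomputable def heatFlow {n : ℕ} {d : ℕ∞} (s : MomSeq n d) (t : ℝ) : MomSeq n d :=
  fun α => (heatPoly s α).eval t

/-- `ℐ_s = {t ∈ ℝ | 𝔭_s(t) is a moment sequence}`. -/
def heatTimes {n : ℕ} {d : ℕ∞} (s : MomSeq n d) : Set ℝ :=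
  {t | heatFlow s t ∈ momentCone n d}

/-- The heat distance `𝔡_s = - inf ℐ_s`. -/
noncomputable def heatDist {n : ℕ} {d : ℕ∞} (s : MomSeq n d) : ℝ :=
  - sInf (heatTimes s)

theorem heatPoly_eval_zero {n : ℕ} {d : ℕ∞} (s : MomSeq n d) (α : MultiIdx n d) :
    (heatPoly s α).eval 0 = s α := by
  unfold heatPoly
  rw [Polynomial.eval_finsetSum, Finset.sum_eq_single (fun _ => 0)]
  · have h : ∀ j : Fin n, ((α.1 j)! : ℝ) / ((α.1 j)! : ℝ) = 1 := fun j =>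
      div_self (by exact_mod_cast (Nat.factorial_pos _).ne')
    simp [h, MultiIdx.lower]
  · intro β _ hβ
    have : ∑ j, β j ≠ 0 := by
      intro h
      apply hβ
      funext j
      exact (Finset.sum_eq_zero_iff.mp h) j (Finset.mem_univ j)
    simp [this]
  · intro h
    exact absurd (by simp) h

theorem heatPoly_derivative {n : ℕ} {d : ℕ∞} (s : MomSeq n d) (α : MultiIdx n d) :
    derivative (heatPoly s α) =
      ∑ j, C ((α.1 j : ℝ) * ((α.1 j : ℝ) - 1)) * heatPoly s (α.lower (Pi.single j 2)) := by
  unfold heatPoly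
  simp only [derivative_sum, derivative_C_mul_X_pow]
  set c : (Fin n → ℕ) → ℝ := fun β =>
    (∏ j, ((α.1 j)! : ℝ) / (((α.1 j - 2 * β j)! : ℝ) * ((β j)! : ℝ))) *
        s (α.lower (fun j => 2 * β j)) with hc
  have h1 : ∀ β : Fin n → ℕ,
      C (c β * ((∑ j, β j : ℕ) : ℝ)) * (X : ℝ[X]) ^ (∑ j, β j - 1) =
        ∑ j, C (c β * (β j : ℝ)) * X ^ (∑ j, β j - 1) := by
    intro β
    rw [← Finset.sum_mul, ← map_sum, ← Finset.mul_sum]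
    push_cast
    rfl
  rw [Finset.sum_congr rfl fun β _ => h1 β, Finset.sum_comm]
  refine Finset.sum_congr rfl fun j _ => ?_
  rw [Finset.mul_sum]
  symm
  by_cases hj : α.1 j ≤ 1
  · rw [Finset.sum_eq_zero, Finset.sum_eq_zero]
    · intro β hβ
      have := Fintype.mem_piFinset.mp hβ j
      have h0 : β j = 0 := by
        rw [Finset.mem_range] at this
        omega
      simp [h0]
    · intro β _
      interval_cases h : α.1 j <;> simp
  push Not at hj
  have term : ∀ β ∈ Fintype.piFinset
        (fun i : Fin n => Finset.range ((α.lower (Pi.single j 2)).1 i / 2 + 1)),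
      C ((α.1 j : ℝ) * ((α.1 j : ℝ) - 1)) *
        (C ((∏ i, (((α.lower (Pi.single j 2)).1 i)! : ℝ) /
            ((((α.lower (Pi.single j 2)).1 i - 2 * β i)! : ℝ) * ((β i)! : ℝ))) *
          s ((α.lower (Pi.single j 2)).lower (fun i => 2 * β i))) * (X : ℝ[X]) ^ (∑ i, β i)) =
      C (c (β + Pi.single j 1) * (((β + Pi.single j 1 : Fin n → ℕ) j : ℕ) : ℝ)) *
        X ^ (∑ i, (β + Pi.single j 1 : Fin n → ℕ) i - 1) := by
    intro β hβ
    have hbj := Fintype.mem_piFinset.mp hβ j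
    simp only [MultiIdx.lower, Finset.mem_range, Pi.single_eq_same] at hbj
    have e1 : ∑ i, (β + Pi.single j 1 : Fin n → ℕ) i - 1 = ∑ i, β i := by
      simp [Pi.add_apply, Finset.sum_add_distrib]
    have e2 : (α.lower (Pi.single j 2)).lower (fun i => 2 * β i) =
        α.lower (fun i => 2 * (β + Pi.single j 1 : Fin n → ℕ) i) := by
      apply Subtype.ext
      funext i
      simp only [MultiIdx.lower, Pi.add_apply]
      by_cases hij : i = j
      · subst hij
        simp only [Pi.single_eq_same]
        omega
      · simp only [Pi.single_eq_of_ne hij]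
        omega
    rw [e1, e2, ← mul_assoc, ← C_mul]
    congr 2
    simp only [hc]
    rw [← mul_assoc, mul_right_comm _ (s _)]
    congr 1
    rw [← Finset.mul_prod_erase _ _ (Finset.mem_univ j),
      ← Finset.mul_prod_erase _ _ (Finset.mem_univ j), ← mul_assoc, mul_right_comm _ (∏ i ∈ _, _)]
    congr 1
    · simp only [MultiIdx.lower, Pi.add_apply, Pi.single_eq_same]
      obtain ⟨a, ha⟩ : ∃ a, α.1 j = a + 2 := ⟨α.1 j - 2, by omega⟩
      rw [ha]
      have e3 : a + 2 - 2 * (β j + 1) = a - 2 * β j := by omega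
      have e4 : a + 2 - 2 = a := by omega
      rw [e3, e4, Nat.factorial_succ (a + 1), Nat.factorial_succ a, Nat.factorial_succ (β j)]
      have p1 : ((a - 2 * β j)! : ℝ) ≠ 0 := by exact_mod_cast (Nat.factorial_pos _).ne'
      have p2 : ((β j)! : ℝ) ≠ 0 := by exact_mod_cast (Nat.factorial_pos _).ne'
      have p3 : (β j : ℝ) + 1 ≠ 0 := by positivity
      push_cast
      field_simp
      ring
    · refine Finset.prod_congr rfl fun i hi => ?_
      have hij : i ≠ j := Finset.ne_of_mem_erase hi
      simp [MultiIdx.lower, Pi.single_eq_of_ne hij]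
  refine Finset.sum_bij_ne_zero (fun β _ _ => β + Pi.single j 1) ?_ ?_ ?_ ?_
  · intro β hβ _
    rw [Fintype.mem_piFinset] at hβ ⊢
    intro i
    have := hβ i
    simp only [MultiIdx.lower, Finset.mem_range, Pi.add_apply] at this ⊢
    by_cases hij : i = j
    · subst hij
      simp only [Pi.single_eq_same] at this ⊢
      omega
    · simp only [Pi.single_eq_of_ne hij] at this ⊢
      omega
  · intro β _ _ β' _ _ h
    exact add_right_cancel h
  · intro β hβ hne
    have hb : 1 ≤ β j := by
      rcases Nat.eq_zero_or_pos (β j) with h0 | h0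
      · simp [h0] at hne
      · exact h0
    have hβ' : (β - Pi.single j 1) + Pi.single j 1 = β := by
      apply tsub_add_cancel_of_le
      intro i
      by_cases hij : i = j
      · subst hij
        simpa using hb
      · simp [Pi.single_eq_of_ne hij]
    have hmem : β - Pi.single j 1 ∈ Fintype.piFinset
        (fun i : Fin n => Finset.range ((α.lower (Pi.single j 2)).1 i / 2 + 1)) := by
      rw [Fintype.mem_piFinset] at hβ ⊢
      intro i
      have := hβ i
      simp only [MultiIdx.lower, Finset.mem_range, Pi.sub_apply] at this ⊢
      by_cases hij : i = j
      · subst hij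
        simp only [Pi.single_eq_same] at this ⊢
        omega
      · simp only [Pi.single_eq_of_ne hij] at this ⊢
        omega
    refine ⟨β - Pi.single j 1, hmem, ?_, hβ'⟩
    rw [term _ hmem, hβ']
    exact hne
  · intro β hβ _
    exact term β hβ

theorem heatPoly_unique {n : ℕ} {d : ℕ∞} (s : MomSeq n d) (p : MultiIdx n d → ℝ[X]) :
    p = heatPoly s ↔ ∀ α : MultiIdx n d, (p α).eval 0 = s α ∧
      derivative (p α) =
        ∑ j, C ((α.1 j : ℝ) * ((α.1 j : ℝ) - 1)) * p (α.lower (Pi.single j 2)) := by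
  constructor
  · rintro rfl α
    exact ⟨heatPoly_eval_zero s α, heatPoly_derivative s α⟩
  · intro h
    have key : ∀ m : ℕ, ∀ α : MultiIdx n d, ∑ i, α.1 i = m → p α = heatPoly s α := by
      intro m
      induction m using Nat.strong_induction_on with
      | _ m ih =>
        intro α hα
        have hd : derivative (p α - heatPoly s α) = 0 := by
          rw [derivative_sub, (h α).2, heatPoly_derivative, sub_eq_zero]
          refine Finset.sum_congr rfl fun j _ => ?_
          by_cases hj : α.1 j = 0
          · simp [hj]
          · rw [ih _ _ (α.lower (Pi.single j 2)) rfl]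
            rw [← hα]
            refine Finset.sum_lt_sum (fun i _ => Nat.sub_le _ _) ⟨j, Finset.mem_univ j, ?_⟩
            simp only [MultiIdx.lower, Pi.single_eq_same]
            omega
        have h0 := derivative_eq_zero.mp hd
        rw [natDegree_eq_zero] at h0
        obtain ⟨x, hx⟩ := h0
        have he : (p α - heatPoly s α).eval 0 = 0 := by
          rw [eval_sub, (h α).1, heatPoly_eval_zero, sub_self]
        rw [← hx, eval_C] at he
        rw [he, C_0] at hx
        exact sub_eq_zero.mp hx.symm
    funext α
    exact key _ α rfl

end HeatMoments

/-!
If `μ` represents `s`, then the convolution of `μ` with the centred Gaussian measure of covariance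
`2r • 1` represents the heat flow `heatFlow s r`: expanding `∏ᵢ (xᵢ + yᵢ) ^ αᵢ` and inserting the
Gaussian moments `(2k)! / k! * r ^ k` reproduces the explicit heat polynomials
(`integral_monomial_add`). As the flow is a one-parameter group (`heatFlow_heatFlow`), the set
`heatTimes s` is closed upwards (`mem_heatTimes_of_le`), hence a ray as soon as it is bounded below.
The lower bound comes from `heatFlow_twoE`: the second moments evolve as `s_{2eⱼ} + 2 t s₀`, and
their sum has to stay nonnegative, where `s₀ > 0` is the mass of a nonzero representing measure.

For `d = ⊤` the moment cone is closed (`isClosed_momentCone_top`), so its preimage `heatTimes s`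
under the continuous flow contains its infimum. Closedness follows from Prokhorov's theorem, the
moments passing to the weak limit because each monomial has its square among the monomials, which
gives uniform integrability (`integrable_and_tendsto_integral_of_sq_le`).

For finite `d` the endpoint may be missing. If it is attained, it lies on the boundary of the cone,
since from an interior point the flow could be continued a little further backwards.
-/

section HeatFlow

open MeasureTheory ProbabilityTheory Filter Topology Polynomial
open scoped Nat NNReal ENNReal

/-! ### Moments of Gaussian measures -/

theorem integrable_pow_gaussianReal (m : ℝ) (v : ℝ≥0) (k : ℕ) :
    Integrable (fun x : ℝ => x ^ k) (gaussianReal m v) := by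
  have := (memLp_id_gaussianReal (μ := m) (v := v) (k : ℝ≥0)).integrable_norm_pow'
  refine this.mono' (by fun_prop) (ae_of_all _ fun x => ?_)
  simp

/-- Integration by parts: the derivative of `φ(x) x ^ (k + 1)` integrates to zero, where `φ` is the
Gaussian density. -/
theorem integral_pow_add_two_gaussianReal (v : ℝ≥0) (k : ℕ) :
    ∫ x, x ^ (k + 2) ∂gaussianReal 0 v = (k + 1) * v * ∫ x, x ^ k ∂gaussianReal 0 v := by
  rcases eq_or_ne v 0 with rfl | hv
  · simp
  have hv' : (v : ℝ) ≠ 0 := by exact_mod_cast hv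
  have hint : ∀ j : ℕ, Integrable (fun x : ℝ => gaussianPDFReal 0 v x * x ^ j) := fun j => by
    have h := integrable_pow_gaussianReal 0 v j
    rw [gaussianReal_of_var_ne_zero _ hv, gaussianPDF_def,
      integrable_withDensity_iff_integrable_smul' (by fun_prop) (by simp)] at h
    simpa [ENNReal.toReal_ofReal (gaussianPDFReal_nonneg 0 v _)] using h
  have hder : ∀ x : ℝ, HasDerivAt (fun x => gaussianPDFReal 0 v x * x ^ (k + 1))
      ((k + 1) * (gaussianPDFReal 0 v x * x ^ k)
        - (v : ℝ)⁻¹ * (gaussianPDFReal 0 v x * x ^ (k + 2))) x := fun x => by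
    have h1 : HasDerivAt (gaussianPDFReal 0 v) (-(x / v) * gaussianPDFReal 0 v x) x := by
      unfold gaussianPDFReal
      have := (((((hasDerivAt_id x).sub_const 0).pow 2).neg.div_const (2 * (v : ℝ))).exp).const_mul
        (√(2 * Real.pi * v))⁻¹
      convert! this using 1
      simp
      field_simp
    convert! h1.mul (hasDerivAt_pow (k + 1) x) using 1
    simp
    field_simp
    ring
  have h0 := integral_eq_zero_of_hasDerivAt_of_integrable hder
    (((hint k).const_mul _).sub ((hint (k + 2)).const_mul _)) (hint (k + 1))
  rw [integral_sub ((hint k).const_mul _) ((hint (k + 2)).const_mul _), integral_const_mul,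
    integral_const_mul] at h0
  rw [integral_gaussianReal_eq_integral_smul hv, integral_gaussianReal_eq_integral_smul hv]
  simp only [smul_eq_mul]
  field_simp at h0
  linarith

theorem integral_pow_two_mul_gaussianReal (r : ℝ≥0) (k : ℕ) :
    ∫ x, x ^ (2 * k) ∂gaussianReal 0 (2 * r) = ((2 * k)! : ℝ) / (k ! : ℝ) * r ^ k := by
  induction k with
  | zero => simp
  | succ k ih =>
    have e : 2 * (k + 1) = 2 * k + 1 + 1 := by ring
    rw [mul_add_one, integral_pow_add_two_gaussianReal, ih, Nat.factorial_succ (2 * k + 1),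
      Nat.factorial_succ (2 * k), Nat.factorial_succ k]
    have : (k ! : ℝ) ≠ 0 := by positivity
    push_cast
    field_simp
    ring

theorem integral_pow_two_mul_add_one_gaussianReal (v : ℝ≥0) (k : ℕ) :
    ∫ x, x ^ (2 * k + 1) ∂gaussianReal 0 v = 0 := by
  induction k with
  | zero => simp
  | succ k ih =>
    rw [show 2 * (k + 1) + 1 = 2 * k + 1 + 2 by ring, integral_pow_add_two_gaussianReal, ih,
      mul_zero]

/-- In one variable, averaging `(x + y) ^ a` over a centred Gaussian `y` of variance `2r` gives the
heat polynomial of the monomial `x ^ a` at time `r`. -/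
theorem integral_add_pow_gaussianReal (r : ℝ≥0) (a : ℕ) (x : ℝ) :
    ∫ y, (x + y) ^ a ∂gaussianReal 0 (2 * r) =
      ∑ k ∈ Finset.range (a / 2 + 1),
        (a ! : ℝ) / (((a - 2 * k)! : ℝ) * (k ! : ℝ)) * x ^ (a - 2 * k) * r ^ k := by
  have hexp : ∀ y : ℝ, (x + y) ^ a =
      ∑ m ∈ Finset.range (a + 1), (x ^ (a - m) * (a.choose m : ℝ)) * y ^ m := fun y => by
    rw [add_comm x y, add_pow]
    exact Finset.sum_congr rfl fun m _ => by ring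
  simp_rw [hexp]
  rw [integral_finsetSum _ fun m _ => (integrable_pow_gaussianReal 0 _ m).const_mul _]
  simp_rw [integral_const_mul]
  symm
  -- only the even powers `m = 2k` of the Gaussian variable contribute
  refine Finset.sum_of_injOn (fun k => 2 * k) (fun _ _ _ _ h => by simpa using h) ?_ ?_ ?_
  · intro k hk
    simp only [Finset.coe_range, Set.mem_Iio] at hk ⊢
    omega
  · intro m hm hm'
    rcases Nat.even_or_odd' m with ⟨k, rfl | rfl⟩
    · refine absurd ⟨k, ?_, rfl⟩ hm'
      simp only [Finset.coe_range, Set.mem_Iio, Finset.mem_range] at hm ⊢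
      omega
    · rw [integral_pow_two_mul_add_one_gaussianReal, mul_zero]
  · intro k hk
    have hk' : 2 * k ≤ a := by
      rw [Finset.mem_range] at hk
      omega
    rw [integral_pow_two_mul_gaussianReal, Nat.cast_choose ℝ hk']
    have h1 : ((2 * k)! : ℝ) ≠ 0 := by positivity
    field_simp

/-! ### Convolution with the heat kernel -/

theorem isFiniteMeasure_of_integrable_monomial {n : ℕ} {d : ℕ∞} {μ : Measure (Fin n → ℝ)}
    (h : ∀ α : MultiIdx n d, Integrable (fun x : Fin n → ℝ => ∏ i, x i ^ α.1 i) μ) :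
    IsFiniteMeasure μ := by
  have := h (MultiIdx.zero n d)
  simpa [MultiIdx.zero, integrable_const_iff] using this

/-- The centred Gaussian measure on `ℝⁿ` with covariance matrix `2r` times the identity, that is,
the heat kernel at time `r`. -/
noncomputable def heatKernel (n : ℕ) (r : ℝ≥0) : Measure (Fin n → ℝ) :=
  Measure.pi fun _ => gaussianReal 0 (2 * r)

instance (n : ℕ) (r : ℝ≥0) : IsProbabilityMeasure (heatKernel n r) := by
  unfold heatKernel
  infer_instance

theorem integrable_monomial_add {n : ℕ} {d : ℕ∞} {μ : Measure (Fin n → ℝ)}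
    (h : ∀ α : MultiIdx n d, Integrable (fun x : Fin n → ℝ => ∏ i, x i ^ α.1 i) μ)
    (r : ℝ≥0) (α : MultiIdx n d) :
    Integrable (fun p : (Fin n → ℝ) × (Fin n → ℝ) => ∏ i, (p.1 i + p.2 i) ^ α.1 i)
      (μ.prod (heatKernel n r)) := by
  have := isFiniteMeasure_of_integrable_monomial h
  have hexp : (fun p : (Fin n → ℝ) × (Fin n → ℝ) => ∏ i, (p.1 i + p.2 i) ^ α.1 i) = fun p =>
      ∑ m ∈ Fintype.piFinset (fun i : Fin n => Finset.range (α.1 i + 1)),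
        (∏ i, p.1 i ^ m i) * ∏ i, (p.2 i ^ (α.1 i - m i) * ((α.1 i).choose (m i) : ℝ)) := by
    funext p
    simp_rw [add_pow, Finset.prod_univ_sum, ← Finset.prod_mul_distrib, mul_assoc]
  rw [hexp]
  refine integrable_finsetSum _ fun m hm => Integrable.mul_prod
    (f := fun x : Fin n → ℝ => ∏ i, x i ^ m i)
    (g := fun y : Fin n → ℝ => ∏ i, (y i ^ (α.1 i - m i) * ((α.1 i).choose (m i) : ℝ))) ?_ ?_
  · refine h ⟨m, le_trans ?_ α.2⟩
    exact_mod_cast Finset.sum_le_sum fun i _ =>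
      Nat.lt_succ_iff.mp (Finset.mem_range.mp (Fintype.mem_piFinset.mp hm i))
  · exact Integrable.fintype_prod (f := fun i y => y ^ (α.1 i - m i) * ((α.1 i).choose (m i) : ℝ))
      fun i => (integrable_pow_gaussianReal 0 _ _).mul_const _

theorem integral_monomial_add {n : ℕ} {d : ℕ∞} {μ : Measure (Fin n → ℝ)} {s : MomSeq n d}
    (h : ∀ α : MultiIdx n d, Integrable (fun x : Fin n → ℝ => ∏ i, x i ^ α.1 i) μ)
    (hs : ∀ α : MultiIdx n d, s α = ∫ x, ∏ i, x i ^ α.1 i ∂μ)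
    (r : ℝ≥0) (α : MultiIdx n d) :
    ∫ p : (Fin n → ℝ) × (Fin n → ℝ), ∏ i, (p.1 i + p.2 i) ^ α.1 i ∂(μ.prod (heatKernel n r)) =
      heatFlow s r α := by
  have := isFiniteMeasure_of_integrable_monomial h
  rw [integral_prod _ (integrable_monomial_add h r α)]
  have hin : ∀ x : Fin n → ℝ, ∫ y, ∏ i, (x i + y i) ^ α.1 i ∂heatKernel n r =
      ∑ β ∈ Fintype.piFinset (fun i : Fin n => Finset.range (α.1 i / 2 + 1)),
        ((∏ i, ((α.1 i)! : ℝ) / (((α.1 i - 2 * β i)! : ℝ) * ((β i)! : ℝ))) *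
          (r : ℝ) ^ ∑ i, β i) * ∏ i, x i ^ (α.lower (fun j => 2 * β j)).1 i := fun x => by
    rw [heatKernel, integral_fintype_prod_eq_prod (fun i y => (x i + y) ^ α.1 i)]
    simp_rw [integral_add_pow_gaussianReal, Finset.prod_univ_sum, Finset.prod_mul_distrib,
      Finset.prod_pow_eq_pow_sum]
    refine Finset.sum_congr rfl fun β _ => ?_
    rw [mul_right_comm]
    rfl
  simp_rw [hin]
  rw [integral_finsetSum _ fun β _ => (h _).const_mul _]
  simp_rw [integral_const_mul, ← hs]
  simp only [heatFlow, heatPoly, eval_finsetSum, eval_mul, eval_C, eval_pow, eval_X]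
  exact Finset.sum_congr rfl fun β _ => by ring

/-- The heat flow preserves the moment cone in forward time: convolving a representing measure with
the heat kernel represents the evolved sequence. -/
theorem heatFlow_mem_momentCone {n : ℕ} {d : ℕ∞} {s : MomSeq n d} (hs : s ∈ momentCone n d)
    {r : ℝ} (hr : 0 ≤ r) : heatFlow s r ∈ momentCone n d := by
  obtain ⟨μ, hμ⟩ := hs
  have h := fun α => (hμ α).1
  have := isFiniteMeasure_of_integrable_monomial h
  lift r to ℝ≥0 using hr
  have hm : AEMeasurable (fun p : (Fin n → ℝ) × (Fin n → ℝ) => p.1 + p.2)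
      (μ.prod (heatKernel n r)) := by fun_prop
  have hc : ∀ α : MultiIdx n d, AEStronglyMeasurable (fun x : Fin n → ℝ => ∏ i, x i ^ α.1 i)
      ((μ.prod (heatKernel n r)).map fun p => p.1 + p.2) := fun α =>
    Continuous.aestronglyMeasurable (by fun_prop)
  refine ⟨(μ.prod (heatKernel n r)).map fun p => p.1 + p.2, fun α => ⟨?_, ?_⟩⟩
  · rw [integrable_map_measure (hc α) hm]
    exact integrable_monomial_add h r α
  · rw [integral_map hm (hc α)]
    exact (integral_monomial_add h (fun α => (hμ α).2) r α).symm

/-! ### The heat flow as a one-parameter group -/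

/-- The heat flow is a one-parameter group: both sides solve the same initial value problem, which
has only one solution by `heatPoly_unique`. -/
theorem heatFlow_heatFlow {n : ℕ} {d : ℕ∞} (s : MomSeq n d) (t r : ℝ) :
    heatFlow (heatFlow s t) r = heatFlow s (t + r) := by
  have h : (fun α => (heatPoly s α).comp (X + C t)) = heatPoly (heatFlow s t) := by
    rw [heatPoly_unique]
    intro α
    refine ⟨by simp [heatFlow], ?_⟩
    rw [derivative_comp, heatPoly_derivative, sum_comp]
    simp [mul_comp]
  funext α
  rw [heatFlow, ← congrFun h α]
  simp [heatFlow, add_comm]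

theorem heatFlow_zero {n : ℕ} {d : ℕ∞} (s : MomSeq n d) : heatFlow s 0 = s :=
  funext fun α => heatPoly_eval_zero s α

theorem continuous_heatFlow {n : ℕ} {d : ℕ∞} (s : MomSeq n d) : Continuous (heatFlow s) :=
  continuous_pi fun α => (heatPoly s α).continuous

theorem mem_heatTimes_of_le {n : ℕ} {d : ℕ∞} {s : MomSeq n d} {t t' : ℝ} (ht : t ∈ heatTimes s)
    (h : t ≤ t') : t' ∈ heatTimes s := by
  have := heatFlow_mem_momentCone ht (sub_nonneg.mpr h)
  rwa [heatFlow_heatFlow, add_sub_cancel] at this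

/-! ### Mass and second moments along the flow -/

theorem heatPoly_zero {n : ℕ} {d : ℕ∞} (s : MomSeq n d) :
    heatPoly s (MultiIdx.zero n d) = C (s (MultiIdx.zero n d)) := by
  have hd : derivative (heatPoly s (MultiIdx.zero n d)) = 0 := by
    rw [heatPoly_derivative]
    simp [MultiIdx.zero]
  rw [← heatPoly_eval_zero s, ← coeff_zero_eq_eval_zero]
  exact eq_C_of_derivative_eq_zero hd

theorem heatFlow_twoE {n : ℕ} {d : ℕ∞} (hd : 2 ≤ d) (s : MomSeq n d) (j : Fin n) (t : ℝ) :
    heatFlow s t (MultiIdx.twoE hd j) =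
      s (MultiIdx.twoE hd j) + 2 * t * s (MultiIdx.zero n d) := by
  have hl : (MultiIdx.twoE hd j).lower (Pi.single j 2) = MultiIdx.zero n d := by
    apply Subtype.ext
    funext i
    simp [MultiIdx.lower, MultiIdx.twoE, MultiIdx.zero]
  have hder : derivative (heatPoly s (MultiIdx.twoE hd j)) = C (2 * s (MultiIdx.zero n d)) := by
    rw [heatPoly_derivative, Finset.sum_eq_single j]
    · rw [hl, heatPoly_zero, ← C_mul]
      congr 2
      norm_num [MultiIdx.twoE]
    · intro i _ hij
      simp [MultiIdx.twoE, Pi.single_eq_of_ne hij]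
    · simp
  have h0 :
      derivative (heatPoly s (MultiIdx.twoE hd j) - C (2 * s (MultiIdx.zero n d)) * X) = 0 := by
    rw [derivative_sub, hder]
    simp
  have h1 := eq_C_of_derivative_eq_zero h0
  rw [coeff_zero_eq_eval_zero, eval_sub, heatPoly_eval_zero] at h1
  have h2 := congrArg (eval t) h1
  simp only [eval_sub, eval_mul, eval_C, eval_X, mul_zero, sub_zero] at h2
  rw [heatFlow]
  linarith

theorem twoE_nonneg_of_mem_momentCone {n : ℕ} {d : ℕ∞} (hd : 2 ≤ d) {s : MomSeq n d}
    (hs : s ∈ momentCone n d) (j : Fin n) : 0 ≤ s (MultiIdx.twoE hd j) := by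
  obtain ⟨μ, hμ⟩ := hs
  rw [(hμ _).2]
  refine integral_nonneg fun x => Finset.prod_nonneg fun i _ => Even.pow_nonneg ?_ _
  by_cases hij : i = j
  · subst hij
    simp [MultiIdx.twoE]
  · simp [MultiIdx.twoE, Pi.single_eq_of_ne hij]

theorem zero_pos_of_mem_momentCone {n : ℕ} {d : ℕ∞} {s : MomSeq n d}
    (hs : s ∈ momentCone n d) (hs0 : s ≠ 0) : 0 < s (MultiIdx.zero n d) := by
  obtain ⟨μ, hμ⟩ := hs
  have := isFiniteMeasure_of_integrable_monomial fun α => (hμ α).1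
  have h : s (MultiIdx.zero n d) = μ.real Set.univ := by
    rw [(hμ _).2]
    simp [MultiIdx.zero]
  rw [h]
  refine lt_of_le_of_ne measureReal_nonneg fun h0 => hs0 ?_
  have hμ0 : μ = 0 := by
    rw [← Measure.measure_univ_eq_zero]
    exact (measureReal_eq_zero_iff).mp h0.symm
  funext α
  rw [(hμ α).2, hμ0]
  simp

/-- The sum of the second moments at a time `t ∈ heatTimes s` is nonnegative, which bounds `t` from
below. -/
theorem le_of_mem_heatTimes {n : ℕ} (hn : 1 ≤ n) {d : ℕ∞} (hd : 2 ≤ d) {s : MomSeq n d}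
    (hs0 : 0 < s (MultiIdx.zero n d)) {t : ℝ} (ht : t ∈ heatTimes s) :
    -((∑ j : Fin n, s (MultiIdx.twoE hd j)) / (2 * (n : ℝ) * s (MultiIdx.zero n d))) ≤ t := by
  have h : 0 ≤ ∑ j : Fin n, heatFlow s t (MultiIdx.twoE hd j) :=
    Finset.sum_nonneg fun j _ => twoE_nonneg_of_mem_momentCone hd ht j
  simp_rw [heatFlow_twoE, Finset.sum_add_distrib] at h
  simp only [Finset.sum_const, Finset.card_univ, Fintype.card_fin, nsmul_eq_mul] at h
  have hn' : (0 : ℝ) < n := by exact_mod_cast hn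
  rw [← neg_div, div_le_iff₀ (by positivity)]
  linarith

/-! ### Weak limits and integrals of unbounded functions -/

section WeakConvergence

variable {E ι : Type*} [MeasurableSpace E] [TopologicalSpace E] [OpensMeasurableSpace E]
  {L : Filter ι} {μs : ι → FiniteMeasure E} {μ : FiniteMeasure E}

theorem tendsto_integral_max_min_of_tendsto (h : Tendsto μs L (𝓝 μ)) {f : E → ℝ}
    (hf : Continuous f) {R : ℝ} (hR : 0 ≤ R) :
    Tendsto (fun i => ∫ x, max (-R) (min (f x) R) ∂(μs i : Measure E)) L
      (𝓝 (∫ x, max (-R) (min (f x) R) ∂(μ : Measure E))) := by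
  let F : BoundedContinuousFunction E ℝ :=
    BoundedContinuousFunction.ofNormedAddCommGroup (fun x => max (-R) (min (f x) R))
      (by fun_prop) R fun x => by
        rw [Real.norm_eq_abs, abs_le]
        exact ⟨le_max_left _ _, max_le (by linarith) (min_le_right _ _)⟩
  exact FiniteMeasure.tendsto_iff_forall_integral_tendsto.mp h F

theorem integrable_max_min (μ : Measure E) [IsFiniteMeasure μ] {f : E → ℝ} (hf : Continuous f)
    {R : ℝ} (hR : 0 ≤ R) : Integrable (fun x => max (-R) (min (f x) R)) μ := by
  refine Integrable.of_bound (C := R) ?_ (ae_of_all _ fun x => ?_)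
  · exact (by fun_prop : Continuous fun x => max (-R) (min (f x) R)).measurable.aestronglyMeasurable
  · rw [Real.norm_eq_abs, abs_le]
    exact ⟨le_max_left _ _, max_le (by linarith) (min_le_right _ _)⟩

/-- A uniform bound on the integrals of a nonnegative continuous function passes to weak limits. -/
theorem integrable_and_integral_le_of_tendsto [NeBot L] (h : Tendsto μs L (𝓝 μ)) {g : E → ℝ}
    (hg : Continuous g) (hg0 : ∀ x, 0 ≤ g x) {C : ℝ}
    (hC : ∀ᶠ i in L, Integrable g (μs i : Measure E) ∧ ∫ x, g x ∂(μs i : Measure E) ≤ C) :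
    Integrable g (μ : Measure E) ∧ ∫ x, g x ∂(μ : Measure E) ≤ C := by
  have hC0 : 0 ≤ C := by
    obtain ⟨i, -, hi⟩ := hC.exists
    exact (integral_nonneg hg0).trans hi
  have htr : ∀ N : ℕ, ∫ x, max (-(N : ℝ)) (min (g x) N) ∂(μ : Measure E) ≤ C := fun N => by
    refine le_of_tendsto (tendsto_integral_max_min_of_tendsto h hg N.cast_nonneg) ?_
    filter_upwards [hC] with i hi
    refine (integral_mono (integrable_max_min _ hg N.cast_nonneg) hi.1 fun x => ?_).trans hi.2
    exact max_le ((neg_nonpos.mpr N.cast_nonneg).trans (hg0 x)) (min_le_left _ _)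
  have htr0 : ∀ (N : ℕ) x, 0 ≤ max (-(N : ℝ)) (min (g x) N) := fun N x =>
    le_max_of_le_right (le_min (hg0 x) N.cast_nonneg)
  have hlim := lintegral_tendsto_of_tendsto_of_monotone (μ := (μ : Measure E))
    (f := fun (N : ℕ) x => ENNReal.ofReal (max (-(N : ℝ)) (min (g x) N)))
    (F := fun x => ENNReal.ofReal (g x))
    (fun N => (ENNReal.continuous_ofReal.comp
      (by fun_prop : Continuous fun x => max (-(N : ℝ)) (min (g x) N))).measurable.aemeasurable)
    (ae_of_all _ fun x N M hNM => by
      have hNM' : (N : ℝ) ≤ M := by exact_mod_cast hNM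
      have e : ∀ K : ℕ, max (-(K : ℝ)) (min (g x) K) = min (g x) K := fun K =>
        max_eq_right ((neg_nonpos.mpr K.cast_nonneg).trans (le_min (hg0 x) K.cast_nonneg))
      simp only [e]
      gcongr)
    (ae_of_all _ fun x => by
      refine tendsto_const_nhds.congr' ?_
      filter_upwards [eventually_ge_atTop ⌈g x⌉₊] with N hN
      have : g x ≤ N := (Nat.le_ceil _).trans (by exact_mod_cast hN)
      rw [min_eq_left this, max_eq_right ((neg_nonpos.mpr N.cast_nonneg).trans (hg0 x))])
  have hle : ∫⁻ x, ENNReal.ofReal (g x) ∂(μ : Measure E) ≤ ENNReal.ofReal C := by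
    refine le_of_tendsto' hlim fun N => ?_
    rw [← ofReal_integral_eq_lintegral_ofReal (integrable_max_min _ hg N.cast_nonneg)
      (ae_of_all _ (htr0 N))]
    exact ENNReal.ofReal_le_ofReal (htr N)
  have hint : Integrable g (μ : Measure E) := by
    refine ⟨hg.measurable.aestronglyMeasurable, ?_⟩
    rw [hasFiniteIntegral_iff_ofReal (ae_of_all _ hg0)]
    exact hle.trans_lt ENNReal.ofReal_lt_top
  refine ⟨hint, ?_⟩
  rw [← ofReal_integral_eq_lintegral_ofReal hint (ae_of_all _ hg0)] at hle
  exact (ENNReal.ofReal_le_ofReal_iff hC0).mp hle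

theorem abs_sub_max_min_le (a : ℝ) {R : ℝ} (hR : 0 < R) :
    |a - max (-R) (min a R)| ≤ a ^ 2 / R := by
  rw [le_div_iff₀ hR]
  rcases le_total a R with h1 | h1
  · rw [min_eq_left h1]
    rcases le_total (-R) a with h2 | h2
    · rw [max_eq_right h2]
      simpa using sq_nonneg a
    · rw [max_eq_left h2, abs_of_nonpos (by linarith)]
      nlinarith
  · rw [min_eq_right h1, max_eq_right (by linarith), abs_of_nonneg (by linarith)]
    nlinarith

theorem abs_integral_sub_integral_max_min_le (μ : Measure E) [IsFiniteMeasure μ] {f : E → ℝ}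
    (hf : Continuous f) (hint : Integrable f μ) (hsq : Integrable (fun x => f x ^ 2) μ) {C R : ℝ}
    (hC : ∫ x, f x ^ 2 ∂μ ≤ C) (hR : 0 < R) :
    |∫ x, f x ∂μ - ∫ x, max (-R) (min (f x) R) ∂μ| ≤ C / R := by
  have hi := integrable_max_min μ hf hR.le
  rw [← integral_sub hint hi]
  refine (abs_integral_le_integral_abs).trans ?_
  refine (integral_mono (hint.sub hi).abs (hsq.div_const R)
    fun x => abs_sub_max_min_le (f x) hR).trans ?_
  rw [integral_div]
  gcongr

/-- Weak convergence together with bounded second moments of a continuous function `f` gives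
convergence of the integrals of `f`: the error made by truncating `f` at height `R` is of order
`1 / R`, uniformly along the filter. -/
theorem integrable_and_tendsto_integral_of_sq_le [NeBot L] (h : Tendsto μs L (𝓝 μ)) {f : E → ℝ}
    (hf : Continuous f) {C : ℝ}
    (hC : ∀ᶠ i in L, Integrable f (μs i : Measure E) ∧
      Integrable (fun x => f x ^ 2) (μs i : Measure E) ∧
      ∫ x, f x ^ 2 ∂(μs i : Measure E) ≤ C) :
    Integrable f (μ : Measure E) ∧
      Tendsto (fun i => ∫ x, f x ∂(μs i : Measure E)) L (𝓝 (∫ x, f x ∂(μ : Measure E))) := by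
  obtain ⟨hsq, hle⟩ := integrable_and_integral_le_of_tendsto h (hf.pow 2)
    (fun x => sq_nonneg (f x)) (hC.mono fun i hi => hi.2)
  have hint : Integrable f (μ : Measure E) :=
    ((memLp_two_iff_integrable_sq hf.measurable.aestronglyMeasurable).mpr hsq).integrable
      one_le_two
  refine ⟨hint, Metric.tendsto_nhds.mpr fun ε hε => ?_⟩
  have hC0 : 0 ≤ C := (integral_nonneg fun x => sq_nonneg (f x)).trans hle
  obtain ⟨R, hR, hCR⟩ : ∃ R : ℝ, 0 < R ∧ C / R < ε / 3 := by
    refine ⟨3 * (C + 1) / ε, by positivity, ?_⟩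
    rw [div_div_eq_mul_div, div_lt_div_iff₀ (by positivity) (by norm_num)]
    nlinarith
  filter_upwards [hC, Metric.tendsto_nhds.mp (tendsto_integral_max_min_of_tendsto h hf hR.le)
    (ε / 3) (by positivity)] with i hi hi'
  have h1 := abs_integral_sub_integral_max_min_le _ hf hi.1 hi.2.1 hi.2.2 hR
  have h2 := abs_integral_sub_integral_max_min_le _ hf hint hsq hle hR
  rw [Real.dist_eq] at hi' ⊢
  rw [abs_lt] at hi' ⊢
  rw [abs_le] at h1 h2
  constructor <;> linarith [h1.1, h1.2, h2.1, h2.2, hi'.1, hi'.2]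

end WeakConvergence

/-! ### Closedness of the cone of full moment sequences -/

/-- Finite measures on `ℝⁿ` with bounded mass and bounded second moments form a relatively compact
set for the weak topology. -/
theorem exists_isCompact_of_sum_sq_le (n : ℕ) (C : ℝ≥0) :
    ∃ K : Set (FiniteMeasure (Fin n → ℝ)), IsCompact K ∧
      ∀ μ : FiniteMeasure (Fin n → ℝ), μ.mass ≤ C →
        Integrable (fun x => ∑ j, x j ^ 2) (μ : Measure (Fin n → ℝ)) →
        ∫ x, ∑ j, x j ^ 2 ∂(μ : Measure (Fin n → ℝ)) ≤ C → μ ∈ K := by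
  have hu : Tendsto (fun N : ℕ => C / ((N : ℝ≥0) + 1)) atTop (𝓝 0) := by
    have := (tendsto_one_div_add_atTop_nhds_zero_nat (𝕜 := ℝ≥0)).const_mul C
    simpa [div_eq_mul_inv] using this
  refine ⟨_, isCompact_setOfPred_finiteMeasure_mass_le_compl_isCompact_le C hu
    (K := fun N : ℕ => Metric.closedBall (0 : Fin n → ℝ) (N + 1))
    (fun N => isCompact_closedBall _ _) (Or.inl inferInstance),
    fun μ hm hint hle => ⟨hm, fun N => ?_⟩⟩
  -- Markov's inequality: outside the ball, `∑ xⱼ²` is at least `(N + 1)² ≥ N + 1`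
  have hsub : (Metric.closedBall (0 : Fin n → ℝ) (N + 1))ᶜ ⊆
      {x | (N : ℝ) + 1 ≤ ∑ j, x j ^ 2} := by
    intro x hx
    rw [Set.mem_compl_iff, mem_closedBall_zero_iff, pi_norm_le_iff_of_nonneg (by positivity)] at hx
    push Not at hx
    obtain ⟨j, hj⟩ := hx
    have h1 : x j ^ 2 ≤ ∑ j, x j ^ 2 :=
      Finset.single_le_sum (f := fun j => x j ^ 2) (fun i _ => sq_nonneg _) (Finset.mem_univ j)
    have h2 : ‖x j‖ ^ 2 = x j ^ 2 := by rw [Real.norm_eq_abs, sq_abs]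
    have hN : (0 : ℝ) ≤ N := N.cast_nonneg
    show (N : ℝ) + 1 ≤ _
    nlinarith
  have hmk := mul_meas_ge_le_integral_of_nonneg
    (ae_of_all _ fun x => Finset.sum_nonneg fun j _ => sq_nonneg (x j)) hint ((N : ℝ) + 1)
  have hmono : (μ : Measure (Fin n → ℝ)).real (Metric.closedBall (0 : Fin n → ℝ) (N + 1))ᶜ ≤
      (μ : Measure (Fin n → ℝ)).real {x | (N : ℝ) + 1 ≤ ∑ j, x j ^ 2} := measureReal_mono hsub
  rw [le_div_iff₀ (by positivity), ← NNReal.coe_le_coe]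
  push_cast
  have e : ((μ (Metric.closedBall (0 : Fin n → ℝ) (N + 1))ᶜ : ℝ≥0) : ℝ) =
      (μ : Measure (Fin n → ℝ)).real (Metric.closedBall (0 : Fin n → ℝ) (N + 1))ᶜ := rfl
  rw [e]
  have hN : (0 : ℝ) ≤ N := N.cast_nonneg
  nlinarith

/-- The cone of full moment sequences is closed: representing measures of sequences near a given
one have bounded mass and second moments, hence accumulate weakly by Prokhorov's theorem, and all
moments pass to the limit since the squared monomials are again monomials. -/
theorem isClosed_momentCone_top (n : ℕ) : IsClosed (momentCone n ⊤) := by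
  rw [isClosed_iff_ultrafilter]
  intro s u hu hS
  have hrep : ∀ s' : MomSeq n ⊤, ∃ μ : FiniteMeasure (Fin n → ℝ), s' ∈ momentCone n ⊤ →
      ∀ α : MultiIdx n ⊤,
        Integrable (fun x : Fin n → ℝ => ∏ i, x i ^ α.1 i) (μ : Measure (Fin n → ℝ)) ∧
        s' α = ∫ x, ∏ i, x i ^ α.1 i ∂(μ : Measure (Fin n → ℝ)) := fun s' => by
    by_cases h : s' ∈ momentCone n ⊤
    · obtain ⟨μ, hμ⟩ := h
      have := isFiniteMeasure_of_integrable_monomial fun α => (hμ α).1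
      exact ⟨⟨μ, this⟩, fun _ => hμ⟩
    · exact ⟨0, fun h' => absurd h' h⟩
  -- `m` picks representing measures; its values off the cone are irrelevant, as the cone is in `u`
  choose m hm using hrep
  have hcoord : ∀ α : MultiIdx n ⊤, Tendsto (fun s' : MomSeq n ⊤ => s' α) u (𝓝 (s α)) := fun α =>
    ((continuous_apply α).tendsto s).mono_left hu
  have hbd : ∀ α : MultiIdx n ⊤, ∀ᶠ s' in (u : Filter (MomSeq n ⊤)), s' α ≤ s α + 1 := fun α =>
    (hcoord α).eventually (eventually_le_nhds (lt_add_one _))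
  have hsq : ∀ j : Fin n, (fun x : Fin n → ℝ =>
      ∏ i, x i ^ (MultiIdx.twoE (d := ⊤) le_top j).1 i) = fun x => x j ^ 2 := fun j => by
    funext x
    rw [Finset.prod_eq_single j]
    · simp [MultiIdx.twoE]
    · intro i _ hij
      simp [MultiIdx.twoE, Pi.single_eq_of_ne hij]
    · simp
  have hzero : ∀ s' ∈ momentCone n ⊤, ((m s').mass : ℝ) = s' (MultiIdx.zero n ⊤) := fun s' h => by
    rw [(hm s' h _).2]
    simp [MultiIdx.zero]
  set C : ℝ≥0 := (max (s (MultiIdx.zero n ⊤) + 1)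
    (∑ j, (s (MultiIdx.twoE le_top j) + 1))).toNNReal
  obtain ⟨K, hK, hKC⟩ := exists_isCompact_of_sum_sq_le n C
  have hKu : ∀ᶠ s' in (u : Filter (MomSeq n ⊤)), m s' ∈ K := by
    filter_upwards [hS, hbd (MultiIdx.zero n ⊤),
      eventually_all.mpr fun j => hbd (MultiIdx.twoE le_top j)] with s' h h0 h2
    have hi : ∀ j, Integrable (fun x : Fin n → ℝ => x j ^ 2) (m s' : Measure (Fin n → ℝ)) :=
      fun j => by simpa only [hsq] using (hm s' h (MultiIdx.twoE le_top j)).1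
    have hv : ∀ j, s' (MultiIdx.twoE le_top j) =
        ∫ x : Fin n → ℝ, x j ^ 2 ∂(m s' : Measure (Fin n → ℝ)) :=
      fun j => by simpa only [hsq] using (hm s' h (MultiIdx.twoE le_top j)).2
    refine hKC _ ?_ (integrable_finsetSum _ fun j _ => hi j) ?_
    · rw [← NNReal.coe_le_coe, hzero s' h]
      exact (h0.trans (le_max_left _ _)).trans (Real.le_coe_toNNReal _)
    · rw [integral_finsetSum _ fun j _ => hi j]
      simp_rw [← hv]
      exact ((Finset.sum_le_sum fun j _ => h2 j).trans (le_max_right _ _)).trans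
        (Real.le_coe_toNNReal _)
  obtain ⟨μ, -, hμ⟩ := hK.ultrafilter_le_nhds (u.map m) (le_principal_iff.mpr hKu)
  have hlim : Tendsto m u (𝓝 μ) := hμ
  refine ⟨μ, fun α => ?_⟩
  obtain ⟨h1, h2⟩ := integrable_and_tendsto_integral_of_sq_le hlim
    (f := fun x : Fin n → ℝ => ∏ i, x i ^ α.1 i) (by fun_prop)
    (C := s ⟨fun i => 2 * α.1 i, le_top⟩ + 1) (by
      filter_upwards [hS, hbd ⟨fun i => 2 * α.1 i, le_top⟩] with s' h hb
      have e : (fun x : Fin n → ℝ => (∏ i, x i ^ α.1 i) ^ 2) =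
          fun x => ∏ i, x i ^ (2 * α.1 i) := by
        funext x
        rw [← Finset.prod_pow]
        exact Finset.prod_congr rfl fun i _ => by rw [← pow_mul, mul_comm]
      have h2 := hm s' h ⟨fun i => 2 * α.1 i, le_top⟩
      rw [e]
      exact ⟨(hm s' h α).1, h2.1, h2.2 ▸ hb⟩)
  refine ⟨h1, tendsto_nhds_unique (hcoord α) (h2.congr' ?_)⟩
  filter_upwards [hS] with s' h
  exact ((hm s' h α).2).symm

/-! ### The heat distance -/

theorem mainTheorem1 (n : ℕ) (hn : 1 ≤ n) (d : ℕ∞) (hd : 2 ≤ d)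
    (s : MomSeq n d) (hs : s ∈ momentCone n d) (hs0 : s ≠ 0) :
    (heatTimes s = Set.Ici (-heatDist s) ∨ heatTimes s = Set.Ioi (-heatDist s)) ∧
    heatDist s ∈ Set.Icc 0
      ((∑ j : Fin n, s (MultiIdx.twoE hd j)) / (2 * (n : ℝ) * s (MultiIdx.zero n d))) ∧
    (d = ⊤ → heatTimes s = Set.Ici (-heatDist s)) ∧
    (d ≠ ⊤ → (heatTimes s = Set.Ici (-heatDist s) ↔
      heatFlow s (-heatDist s) ∈ frontier (momentCone n d) ∩ momentCone n d)) := by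
  have hpos := zero_pos_of_mem_momentCone hs hs0
  have hlow : ∀ t ∈ heatTimes s, _ ≤ t := fun t ht => le_of_mem_heatTimes hn hd hpos ht
  have hbdd : BddBelow (heatTimes s) := ⟨_, hlow⟩
  have h0 : (0 : ℝ) ∈ heatTimes s := by
    show heatFlow s 0 ∈ momentCone n d
    rwa [heatFlow_zero]
  have hIci : heatTimes s = Set.Ici (-heatDist s) ↔ -heatDist s ∈ heatTimes s := by
    refine ⟨fun h => h ▸ Set.self_mem_Ici, fun h => Set.Subset.antisymm (fun t ht => ?_)
      fun t ht => mem_heatTimes_of_le h ht⟩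
    rw [heatDist, neg_neg]
    exact csInf_le hbdd ht
  refine ⟨?_, ⟨?_, ?_⟩, ?_, fun _ => ?_⟩
  · by_cases h : -heatDist s ∈ heatTimes s
    · exact Or.inl (hIci.mpr h)
    · refine Or.inr (Set.Subset.antisymm (fun t ht => ?_) fun t ht => ?_)
      · show -heatDist s < t
        refine lt_of_le_of_ne ?_ fun e => h (by rwa [e])
        rw [heatDist, neg_neg]
        exact csInf_le hbdd ht
      · rw [Set.mem_Ioi, heatDist, neg_neg] at ht
        obtain ⟨t', ht', hlt⟩ := exists_lt_of_csInf_lt ⟨0, h0⟩ ht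
        exact mem_heatTimes_of_le ht' hlt.le
  · exact neg_nonneg.mpr (csInf_le hbdd h0)
  · exact neg_le.mp (le_csInf ⟨0, h0⟩ hlow)
  · rintro rfl
    rw [hIci, heatDist, neg_neg]
    exact ((isClosed_momentCone_top n).preimage (continuous_heatFlow s)).csInf_mem ⟨0, h0⟩ hbdd
  · rw [hIci]
    refine ⟨fun h => ⟨⟨subset_closure h, fun hint => ?_⟩, h⟩, fun h => h.2⟩
    -- an interior point could be flowed backwards for a short time without leaving the cone
    have hnhds : heatTimes s ∈ 𝓝 (-heatDist s) :=
      (continuous_heatFlow s).continuousAt.preimage_mem_nhds (mem_interior_iff_mem_nhds.mp hint)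
    obtain ⟨ε, hε, hball⟩ := Metric.mem_nhds_iff.mp hnhds
    have hmem : -heatDist s - ε / 2 ∈ heatTimes s := hball <| by
      rw [Metric.mem_ball, Real.dist_eq, abs_lt]
      constructor <;> linarith
    have := csInf_le hbdd hmem
    rw [heatDist, neg_neg] at this
    linarith

end HeatFlow
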